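/- Let $\phi(x,y,z)=x^6+y^6+z^6-2x^3y^3-2x^3z^3-2y^3z^3$. For $k\in\mathbb{Q}^*$ let $E_k$ be the elliptic curve $y^2=x^3+k$ over $\mathbb{Q}$; its rank is the rank of the abelian group $E_k(\mathbb{Q})$, and independence means linear independence over $\mathbb{Z}$ in $E_k(\mathbb{Q})$. A \emph{sextic chain for $k$} consists of three triples $(x_i,y_i,z_i)\in\mathbb{Q}^3$ with $\phi(x_i,y_i,z_i)=4k$ for $i=1,2,3$; its nine points are $(x_iy_i,\,(x_i^3+y_i^3-z_i^3)/2)$, $(y_iz_i,\,(y_i^3+z_i^3-x_i^3)/2)$, $(x_iz_i,\,(x_i^3+z_i^3-y_i^3)/2)$ for $i=1,2,3$. (1) Let $k=44906825622115054978352852841$. The triples $(100958,425,113259)$, $(-7150,-6001,75081)$, $(-60010,-715,59223)$ form a sextic chain for $k$. Multiplied by $6$, they are the values at $m=1$, $n=2$ of the following nine polynomials, where $t=m^2-mn+n^2$ and $s=3(m-n)t^6+(2m-n)(m-2n)t^4-3(m^3+mn^2-n^3)t^2-3tm^2+m-2n$: $$\begin{aligned} x_1&=(m-n)((m+n)t+2)(t^3-1)s,\\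 y_1&=((m-2n)t-1)((2m-n)t+1)^2(2t^2+m-2n)((m-n)t^3+t^2+m),\\ z_1&=3(m-n)^2t^{11}+9m(m-n)^2t^9+(19m^4-68m^3n+81m^2n^2-35mn^3+4n^4)t^7\\ &\quad+(4m^5-67m^4n+163m^3n^2-176m^2n^3+104mn^4-26n^5)t^5\\ &\quad-(23m^4-22m^3n-18m^2n^2+32mn^3-13n^4)t^4-(19m^3-36m^2n+39mn^2-14n^3)t^3\\ &\quad+t(2m^4-7m^3n-6m^2n^2+8mn^3-4n^4)+(m-2n)(5m^2-5mn+2n^2),\\ x_2&=-(m-n)((m+n)t+2)((m-2n)t-1)((2m-n)t+1)(2t^2+m-2n)(t^3-1),\\ y_2&=-((2m-n)t+1)((m-n)t^3+t^2+m)s,\\ z_2&=3(m-n)^2t^{11}-(14m^4-37m^3n+36m^2n^2-22mn^3+8n^4)t^7\\ &\quad-(23m^5-98m^4n+140m^3n^2-103m^2n^3+37mn^4-4n^5)t^5\\ &\quad+(m^4+58m^3n-90m^2n^2+46mn^3-5n^4)t^4+(23m^3-12m^2n-9mn^2+8n^3)t^3\\ &\quad+(11m^4-28m^3n+39m^2n^2-19mn^3+2n^4)t-(m-2n)(m^2+2mn-2n^2),\\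 x_3&=((m-2n)t-1)((m-n)t^3+t^2+m)s,\\ y_3&=(m-n)((m+n)t+2)((2m-n)t+1)^2(2t^2+m-2n)(t^3-1),\\ z_3&=3(m-n)^2t^{11}+9(m-n)^3t^9+(13m^4-35m^3n+36m^2n^2-14mn^3+n^4)t^7\\ &\quad+(19m^5-55m^4n+79m^3n^2-44m^2n^3-mn^4+7n^5)t^5\\ &\quad+(4m^4-17m^3n+54m^2n^2-41mn^3+10n^4)t^4-2(11m^3-21m^2n+5n^3)t^3\\ &\quad-t(22m^4-68m^3n+78m^2n^2-47mn^3+10n^4)-(m-2n)(4m^2-7mn+4n^2). \end{aligned}$$ The nine points of the chain are exactly the seven distinct points $(42907150,-211912492824721)$, $(48135075,211912569590346)$, $(11434402122,1240928701242633)$, $(-450561081,211696384806720)$, $(-536829150,211546966949721)$, $(-42344445,211912127298846)$, $(-3553972230,-4195525176279)$ of $E_k(\mathbb{Q})$. The first six of them are independent, and $E_k$ has rank at least $6$. (2) Let $k=60881141602872940726223731917150516833400$. The triples $(14900543,-2461462,15194895)$, $(12571823,2923703,13884990)$, $(4528874,11547071,13636239)$ form a sextic chain for $k$. The negatives of its nine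 points are the nine distinct points $P_1=(-36677120373866,107436818637424863748)$, $P_2=(226412186327985,-3415747486107335266755)$, $P_3=(-37401656636490,-92523324542363200620)$, $P_4=(36756276620569,332475185129096665153)$, $P_5=(174559636636770,-2319461032255991683920)$, $P_6=(40595586917970,-357467113076423815080)$, $P_7=(52295229628054,451550293014200834692)$, $P_8=(61756808264886,-544440667643008046316)$, $P_9=(157458619905969,-1991177257485343473603)$ of $E_k(\mathbb{Q})$, in some order. The points $P_1,P_2,P_3,P_4,P_5,P_8$ are independent, and $E_k$ has rank at least $6$. (3) Let $k=229891413360054031954393983295868363569423090881015580599000$. The triples $(17217348683,-3153451318,17759190363)$, $(14274889211,3650986211,16104056910)$, $(11570059211,7442013386,15638543835)$ form a sextic chain for $k$. Its nine points are distinct points of $E_k(\mathbb{Q})$; some six of them are independent, the subgroup that all nine generate has rank exactly $6$, and $E_k$ has rank at least $6$. (4) Let $k=2929940522529734819579573131655813436044395771052383353330586891185336$. The triples $(1042841875523,-135605153365,1048238044134)$, $(910149016979,171247082018,973598311203)$, $(895404734483,197212896290,968789083299)$ form a sextic chain for $k$. Its nine points are distinct points of $E_k(\mathbb{Q})$; some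 six of them are independent, the subgroup that all nine generate has rank exactly $6$, and $E_k$ has rank at least $6$. -/

import Mathlib

/-- The sextic form `φ(x, y, z) = x⁶ + y⁶ + z⁶ - 2x³y³ - 2x³z³ - 2y³z³`. -/
def sexticForm (x y z : ℚ) : ℚ :=
  x ^ 6 + y ^ 6 + z ^ 6 - 2 * x ^ 3 * y ^ 3 - 2 * x ^ 3 * z ^ 3 - 2 * y ^ 3 * z ^ 3

/-- The three rows `(xᵢ, yᵢ, zᵢ)` of `c` satisfy
`φ(x₁, y₁, z₁) = φ(x₂, y₂, z₂) = φ(x₃, y₃, z₃) = 4k`. -/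
def IsSexticChain (k : ℚ) (c : Fin 3 → Fin 3 → ℚ) : Prop :=
  ∀ i, sexticForm (c i 0) (c i 1) (c i 2) = 4 * k

/-- The Mordell curve `y² = x³ + k` over `ℚ`. -/
def mordellCurve (k : ℚ) : WeierstrassCurve ℚ where
  a₁ := 0
  a₂ := 0
  a₃ := 0
  a₄ := 0
  a₆ := k

theorem mordellCurve_equation_iff (k x y : ℚ) :
    (mordellCurve k).toAffine.Equation x y ↔ y ^ 2 = x ^ 3 + k := by
  rw [WeierstrassCurve.Affine.equation_iff]
  simp [mordellCurve]

theorem mordellCurve_isElliptic {k : ℚ} (hk : k ≠ 0) : (mordellCurve k).IsElliptic := by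
  refine ⟨isUnit_iff_ne_zero.mpr ?_⟩
  have h : (mordellCurve k).Δ = -432 * k ^ 2 := by
    simp only [mordellCurve, WeierstrassCurve.Δ, WeierstrassCurve.b₂, WeierstrassCurve.b₄,
      WeierstrassCurve.b₆, WeierstrassCurve.b₈]
    ring
  rw [h]
  exact mul_ne_zero (by norm_num) (pow_ne_zero 2 hk)

/-- The Mordell–Weil group over `ℚ` of `y² = x³ + k` (with the point at infinity as zero). -/
abbrev MordellGroup (k : ℚ) : Type := (mordellCurve k).toAffine.Point

/-- `P i` is the affine point with coordinates `L i`, for every `i`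
(in particular, `L i` lies on the curve). -/
def HaveCoords {ι : Type} (k : ℚ) (P : ι → MordellGroup k) (L : ι → ℚ × ℚ) : Prop :=
  ∀ i, ∃ h : (mordellCurve k).toAffine.Nonsingular (L i).1 (L i).2,
    P i = WeierstrassCurve.Affine.Point.some (L i).1 (L i).2 h

/-- The nine pairs `(xy, (x³+y³-z³)/2)`, `(yz, (y³+z³-x³)/2)`, `(xz, (x³+z³-y³)/2)`
attached to the three rows `(x, y, z)` of a chain. -/
def chainCoords (c : Fin 3 → Fin 3 → ℚ) (ij : Fin 3 × Fin 3) : ℚ × ℚ :=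
  let x := c ij.1 0
  let y := c ij.1 1
  let z := c ij.1 2
  ![(x * y, (x ^ 3 + y ^ 3 - z ^ 3) / 2),
    (y * z, (y ^ 3 + z ^ 3 - x ^ 3) / 2),
    (x * z, (x ^ 3 + z ^ 3 - y ^ 3) / 2)] ij.2

/-- The parametric sextic chain in the parameters `m`, `n`, where `t = m² - mn + n²`. -/
def parametricChain (m n : ℚ) : Fin 3 → Fin 3 → ℚ :=
  let t := m ^ 2 - m * n + n ^ 2
  let s := 3 * (m - n) * t ^ 6 + (2 * m - n) * (m - 2 * n) * t ^ 4
    - 3 * (m ^ 3 + m * n ^ 2 - n ^ 3) * t ^ 2 - 3 * t * m ^ 2 + m - 2 * n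
  ![![(m - n) * ((m + n) * t + 2) * (t ^ 3 - 1) * s,
      ((m - 2 * n) * t - 1) * ((2 * m - n) * t + 1) ^ 2 * (2 * t ^ 2 + m - 2 * n)
        * ((m - n) * t ^ 3 + t ^ 2 + m),
      3 * (m - n) ^ 2 * t ^ 11 + 9 * m * (m - n) ^ 2 * t ^ 9
        + (19 * m ^ 4 - 68 * m ^ 3 * n + 81 * m ^ 2 * n ^ 2 - 35 * m * n ^ 3 + 4 * n ^ 4) * t ^ 7
        + (4 * m ^ 5 - 67 * m ^ 4 * n + 163 * m ^ 3 * n ^ 2 - 176 * m ^ 2 * n ^ 3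
          + 104 * m * n ^ 4 - 26 * n ^ 5) * t ^ 5
        - (23 * m ^ 4 - 22 * m ^ 3 * n - 18 * m ^ 2 * n ^ 2 + 32 * m * n ^ 3 - 13 * n ^ 4) * t ^ 4
        - (19 * m ^ 3 - 36 * m ^ 2 * n + 39 * m * n ^ 2 - 14 * n ^ 3) * t ^ 3
        + t * (2 * m ^ 4 - 7 * m ^ 3 * n - 6 * m ^ 2 * n ^ 2 + 8 * m * n ^ 3 - 4 * n ^ 4)
        + (m - 2 * n) * (5 * m ^ 2 - 5 * m * n + 2 * n ^ 2)],
    ![-(m - n) * ((m + n) * t + 2) * ((m - 2 * n) * t - 1) * ((2 * m - n) * t + 1)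
        * (2 * t ^ 2 + m - 2 * n) * (t ^ 3 - 1),
      -((2 * m - n) * t + 1) * ((m - n) * t ^ 3 + t ^ 2 + m) * s,
      3 * (m - n) ^ 2 * t ^ 11
        - (14 * m ^ 4 - 37 * m ^ 3 * n + 36 * m ^ 2 * n ^ 2 - 22 * m * n ^ 3 + 8 * n ^ 4) * t ^ 7
        - (23 * m ^ 5 - 98 * m ^ 4 * n + 140 * m ^ 3 * n ^ 2 - 103 * m ^ 2 * n ^ 3
          + 37 * m * n ^ 4 - 4 * n ^ 5) * t ^ 5
        + (m ^ 4 + 58 * m ^ 3 * n - 90 * m ^ 2 * n ^ 2 + 46 * m * n ^ 3 - 5 * n ^ 4) * t ^ 4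
        + (23 * m ^ 3 - 12 * m ^ 2 * n - 9 * m * n ^ 2 + 8 * n ^ 3) * t ^ 3
        + (11 * m ^ 4 - 28 * m ^ 3 * n + 39 * m ^ 2 * n ^ 2 - 19 * m * n ^ 3 + 2 * n ^ 4) * t
        - (m - 2 * n) * (m ^ 2 + 2 * m * n - 2 * n ^ 2)],
    ![((m - 2 * n) * t - 1) * ((m - n) * t ^ 3 + t ^ 2 + m) * s,
      (m - n) * ((m + n) * t + 2) * ((2 * m - n) * t + 1) ^ 2 * (2 * t ^ 2 + m - 2 * n)
        * (t ^ 3 - 1),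
      3 * (m - n) ^ 2 * t ^ 11 + 9 * (m - n) ^ 3 * t ^ 9
        + (13 * m ^ 4 - 35 * m ^ 3 * n + 36 * m ^ 2 * n ^ 2 - 14 * m * n ^ 3 + n ^ 4) * t ^ 7
        + (19 * m ^ 5 - 55 * m ^ 4 * n + 79 * m ^ 3 * n ^ 2 - 44 * m ^ 2 * n ^ 3
          - m * n ^ 4 + 7 * n ^ 5) * t ^ 5
        + (4 * m ^ 4 - 17 * m ^ 3 * n + 54 * m ^ 2 * n ^ 2 - 41 * m * n ^ 3 + 10 * n ^ 4) * t ^ 4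
        - 2 * (11 * m ^ 3 - 21 * m ^ 2 * n + 5 * n ^ 3) * t ^ 3
        - t * (22 * m ^ 4 - 68 * m ^ 3 * n + 78 * m ^ 2 * n ^ 2 - 47 * m * n ^ 3 + 10 * n ^ 4)
        - (m - 2 * n) * (4 * m ^ 2 - 7 * m * n + 4 * n ^ 2)]]

/-- The numerical chain given by the parameters `m = 1`, `n = 2`. -/
def chain₁ : Fin 3 → Fin 3 → ℚ :=
  ![![100958, 425, 113259],
    ![-7150, -6001, 75081],
    ![-60010, -715, 59223]]

/-- The second numerical chain. -/
def chain₂ : Fin 3 → Fin 3 → ℚ :=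
  ![![14900543, -2461462, 15194895],
    ![12571823, 2923703, 13884990],
    ![4528874, 11547071, 13636239]]

/-- The third numerical chain. -/
def chain₃ : Fin 3 → Fin 3 → ℚ :=
  ![![17217348683, -3153451318, 17759190363],
    ![14274889211, 3650986211, 16104056910],
    ![11570059211, 7442013386, 15638543835]]

/-- A further numerical chain of the same family as `chain₂` and `chain₃`. -/
def chain₄ : Fin 3 → Fin 3 → ℚ :=
  ![![1042841875523, -135605153365, 1048238044134],
    ![910149016979, 171247082018, 973598311203],
    ![895404734483, 197212896290, 968789083299]]

/-- Seven rational points on `y² = x³ + 44906825622115054978352852841`. -/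
def coords₁ : Fin 7 → ℚ × ℚ :=
  ![(42907150, -211912492824721),
    (48135075, 211912569590346),
    (11434402122, 1240928701242633),
    (-450561081, 211696384806720),
    (-536829150, 211546966949721),
    (-42344445, 211912127298846),
    (-3553972230, -4195525176279)]

/-- Nine rational points on `y² = x³ + 60881141602872940726223731917150516833400`. -/
def coords₂ : Fin 9 → ℚ × ℚ :=
  ![(-36677120373866, 107436818637424863748),
    (226412186327985, -3415747486107335266755),
    (-37401656636490, -92523324542363200620),
    (36756276620569, 332475185129096665153),
    (174559636636770, -2319461032255991683920),
    (40595586917970, -357467113076423815080),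
    (52295229628054, 451550293014200834692),
    (61756808264886, -544440667643008046316),
    (157458619905969, -1991177257485343473603)]

/-! Membership in the curve, the chain equations and the equalities of point sets are arithmetic;
the substance is independence, proved by 2-descent with local characters. If `-K` is not a rational
cube, `y² = x³ + K` has no rational 2-torsion. In an abelian group without 2-torsion, points are
independent once no nonempty subsum lies in `2A` (`linearIndependent_int_of_sum_ne_two_nsmul`). For
a cube root `θ` of `-K` in an extension field, `P ↦ x(P) - θ` is multiplicative modulo squares
(`isSquare_descentMap_add`), so doubled points go to squares. Taking `θ ∈ ℤ_p`, lifted by Hensel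
from a simple root `r` mod `p`, turns this into a Legendre symbol: if the sum of the `P i` over `S`
is a double, the product of the symbols `((X i - r)/p)` over `S` is not `-1`. Six primes give a 6×6
table of signs in which every nonempty `S` is excluded by some row
(`linearIndependent_of_legendreSym`). The upper bound 6 for chains 3 and 4 comes from three explicit
relations between sums of pairs, which express the other three points through six of them
(`rank_span_range_eq_six`). -/

open WeierstrassCurve.Affine (Point)

/-! ### Independence from reduction modulo 2 -/

/-- In an abelian group without `2`-torsion, a finite family is independent as soon as no sum over a
nonempty subfamily is divisible by `2`. -/
theorem linearIndependent_int_of_sum_ne_two_nsmul {ι A : Type*} [Fintype ι] [AddCommGroup A]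
    (htors : ∀ a : A, 2 • a = 0 → a = 0) (v : ι → A)
    (h : ∀ (S : Finset ι) (a : A), ∑ i ∈ S, v i = 2 • a → S = ∅) :
    LinearIndependent ℤ v := by
  classical
  rw [Fintype.linearIndependent_iff]
  have even_of_sum_eq_zero (g : ι → ℤ) (hg : ∑ i, g i • v i = 0) (i : ι) : Even (g i) := by
    -- Integer division rounds down here, so `g i = 2 (g i / 2) + 1` for odd `g i` of either sign;
    -- the relation thus makes the sum over odd coefficients a double.
    have hS := h {i | Odd (g i)} (-∑ i, (g i / 2) • v i) (by
      rw [smul_neg, eq_neg_iff_add_eq_zero, ← hg, Finset.sum_filter, Finset.smul_sum,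
        ← Finset.sum_add_distrib]
      refine Finset.sum_congr rfl fun j _ => ?_
      rw [two_nsmul, ← add_smul]
      split_ifs with hj
      · nth_rw 1 [← one_zsmul (v j)]
        rw [← add_smul]
        congr 1
        obtain ⟨m, hm⟩ := hj
        omega
      · rw [zero_add]
        congr 1
        obtain ⟨m, hm⟩ := Int.not_odd_iff_even.mp hj
        omega)
    by_contra hi
    have : i ∈ (∅ : Finset ι) := hS ▸ by simpa using hi
    simp at this
  -- Infinite descent: all coefficients are even, and halving them gives another relation because
  -- there is no 2-torsion.
  have pow_dvd (n : ℕ) : ∀ g : ι → ℤ, ∑ i, g i • v i = 0 → ∀ i, (2 : ℤ) ^ n ∣ g i := by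
    induction n with
    | zero => simp
    | succ n ih =>
      intro g hg i
      choose f hf using fun i => (even_of_sum_eq_zero g hg i).two_dvd
      have hf0 : ∑ i, f i • v i = 0 := htors _ (by
        rw [← hg, Finset.smul_sum]
        refine Finset.sum_congr rfl fun j _ => ?_
        rw [hf j, mul_smul, two_nsmul, two_zsmul])
      rw [hf i, pow_succ']
      exact mul_dvd_mul_left _ (ih f hf0 i)
  intro g hg i
  by_contra hi
  -- The exponent `|g i|` suffices, since `2 ^ |g i| > |g i|`.
  have hlt := Int.le_of_dvd (abs_pos.mpr hi) ((dvd_abs _ _).mpr (pow_dvd (g i).natAbs g hg i))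
  rw [Int.abs_eq_natAbs] at hlt
  have := Nat.lt_two_pow_self (n := (g i).natAbs)
  exact absurd (by exact_mod_cast hlt) (not_le.mpr this)

theorem IsSquare.of_mul_mul_self {F : Type*} [Field F] {a d : F} (hd : d ≠ 0)
    (h : IsSquare (a * (d * d))) : IsSquare a := by
  obtain ⟨w, hw⟩ := h
  exact ⟨w / d, by field_simp; linear_combination hw⟩

/-! ### The 2-descent map -/

section Descent

variable {k : ℚ} {F : Type*} [Field F]

/-- The function `P ↦ x(P) - θ` of the `2`-descent. -/
def descentMap (θ : F) : MordellGroup k → F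
  | .zero => 1
  | .some x _ _ => (x : F) - θ

theorem descentMap_zero (θ : F) : descentMap θ (0 : MordellGroup k) = 1 := rfl

variable [CharZero F] (θ : F)

/-- If `y = L(x)` is the chord or tangent, then `x³ + k - L(x)²` has roots `x₁, x₂, x₃`, with `x₃`
the abscissa of the sum. At `x = θ` the cubic `x³ + k` vanishes, which leaves `L(θ)² = ∏ (xᵢ - θ)`.
Using products instead of quotients avoids any nonvanishing condition. -/
theorem isSquare_descentMap_add (hθ : θ ^ 3 = -(k : F)) (P Q : MordellGroup k) :
    IsSquare (descentMap θ (P + Q) * (descentMap θ P * descentMap θ Q)) := by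
  rcases P with _ | ⟨x₁, y₁, h₁⟩
  · change IsSquare (descentMap θ (0 + Q) * (1 * descentMap θ Q))
    rw [zero_add, one_mul]
    exact ⟨_, rfl⟩
  rcases Q with _ | ⟨x₂, y₂, h₂⟩
  · change IsSquare (descentMap θ (Point.some x₁ y₁ h₁ + 0) * (descentMap θ (.some x₁ y₁ h₁) * 1))
    rw [add_zero, mul_one]
    exact ⟨_, rfl⟩
  by_cases hxy : x₁ = x₂ ∧ y₁ = (mordellCurve k).toAffine.negY x₂ y₂
  · rw [WeierstrassCurve.Affine.Point.add_of_Y_eq hxy.1 hxy.2, descentMap_zero, one_mul]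
    obtain ⟨rfl, -⟩ := hxy
    exact ⟨_, rfl⟩
  · rw [WeierstrassCurve.Affine.Point.add_some hxy]
    have key := WeierstrassCurve.Affine.addPolynomial_slope h₁.1 h₂.1 hxy
    rw [WeierstrassCurve.Affine.addPolynomial_eq, neg_inj, Cubic.prod_X_sub_C_eq,
      Cubic.toPoly_injective, Cubic.mk.injEq] at key
    obtain ⟨-, ha, hb, hc⟩ := key
    change IsSquare ((((mordellCurve k).toAffine.addX x₁ x₂
      ((mordellCurve k).toAffine.slope x₁ x₂ y₁ y₂) : ℚ) - θ) * ((x₁ - θ) * (x₂ - θ)))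
    generalize (mordellCurve k).toAffine.addX x₁ x₂
      ((mordellCurve k).toAffine.slope x₁ x₂ y₁ y₂) = x₃ at *
    generalize (mordellCurve k).toAffine.slope x₁ x₂ y₁ y₂ = ℓ at *
    simp only [mordellCurve, zero_mul, sub_zero, add_zero, neg_zero] at ha hb hc
    have ha' := congrArg (Rat.cast (K := F)) ha
    have hb' := congrArg (Rat.cast (K := F)) hb
    have hc' := congrArg (Rat.cast (K := F)) hc
    push_cast at ha' hb' hc'
    -- The witness is `L(θ)`.
    refine ⟨(ℓ : F) * (θ - x₁) + y₁, ?_⟩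
    linear_combination θ ^ 2 * ha' + θ * hb' + hc' - hθ

/-- A zero would make `θ` rational. Nonvanishing is what allows square factors to be cancelled
below. -/
theorem descentMap_ne_zero (hk : ∀ x : ℚ, x ^ 3 ≠ -k) (hθ : θ ^ 3 = -(k : F))
    (P : MordellGroup k) : descentMap θ P ≠ 0 := by
  rcases P with _ | ⟨x, y, h⟩
  · exact one_ne_zero
  · intro h0
    apply hk x
    have : (x : F) = θ := sub_eq_zero.mp h0
    rw [← this] at hθ
    exact_mod_cast hθ

theorem isSquare_descentMap_sum (hk : ∀ x : ℚ, x ^ 3 ≠ -k) (hθ : θ ^ 3 = -(k : F)) {ι : Type*}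
    (S : Finset ι) (P : ι → MordellGroup k) :
    IsSquare (descentMap θ (∑ i ∈ S, P i) * ∏ i ∈ S, descentMap θ (P i)) := by
  classical
  induction S using Finset.induction_on with
  | empty => simp [descentMap_zero]
  | insert a S ha ih =>
    rw [Finset.sum_insert ha, Finset.prod_insert ha]
    have h := (isSquare_descentMap_add θ hθ (P a) (∑ i ∈ S, P i)).mul ih
    refine .of_mul_mul_self (descentMap_ne_zero θ hk hθ (∑ i ∈ S, P i)) ?_
    refine (congrArg IsSquare ?_).mpr h
    ring

/-- The values at `Q + Q` and at `Q` each enter twice when the two square relations are multiplied,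
so they cancel. -/
theorem isSquare_prod_descentMap (hk : ∀ x : ℚ, x ^ 3 ≠ -k) (hθ : θ ^ 3 = -(k : F)) {ι : Type*}
    (S : Finset ι) (P : ι → MordellGroup k) {Q : MordellGroup k} (hQ : ∑ i ∈ S, P i = 2 • Q) :
    IsSquare (∏ i ∈ S, descentMap θ (P i)) := by
  have h := isSquare_descentMap_sum θ hk hθ S P
  have h2 := isSquare_descentMap_add θ hθ Q Q
  rw [hQ, two_nsmul] at h
  refine .of_mul_mul_self (mul_ne_zero (descentMap_ne_zero θ hk hθ (Q + Q))
    (descentMap_ne_zero θ hk hθ Q)) ?_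
  refine (congrArg IsSquare ?_).mpr (h.mul h2)
  ring

end Descent

theorem two_nsmul_mordell_ne_zero {k : ℚ} (hk : ∀ x : ℚ, x ^ 3 ≠ -k) (P : MordellGroup k)
    (hP : 2 • P = 0) : P = 0 := by
  rcases P with _ | ⟨x, y, h⟩
  · rfl
  · exfalso
    rw [two_nsmul, ← eq_neg_iff_add_eq_zero, WeierstrassCurve.Affine.Point.neg_some,
      WeierstrassCurve.Affine.Point.some.injEq] at hP
    have hy : y = -y := by
      simpa [WeierstrassCurve.Affine.negY, mordellCurve] using hP.2
    have hy0 : y = 0 := by linarith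
    have he := (mordellCurve_equation_iff k x y).mp h.1
    subst hy0
    exact hk x (by linear_combination -he)

/-! ### From `p`-adic squares to Legendre symbols -/

section Padic

variable (p : ℕ) [Fact p.Prime]

/-- Hensel: the derivative `3r²` is a unit, so `r` lifts to a root congruent to it. -/
theorem PadicInt.exists_cube_root {K r : ℤ} (hr : (p : ℤ) ∣ r ^ 3 + K)
    (hd : ¬ (p : ℤ) ∣ 3 * r ^ 2) :
    ∃ θ : ℤ_[p], θ ^ 3 = -(K : ℤ_[p]) ∧ PadicInt.toZMod θ = (r : ZMod p) := by
  set f : Polynomial ℤ_[p] := Polynomial.X ^ 3 + Polynomial.C (K : ℤ_[p])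
  have hf (z : ℤ_[p]) : Polynomial.aeval z f = z ^ 3 + K := by simp [f]
  have hf' : Polynomial.aeval (r : ℤ_[p]) (Polynomial.derivative f)
      = ((3 * r ^ 2 : ℤ) : ℤ_[p]) := by
    simp [f]
    norm_num
  have h1 : ‖((3 * r ^ 2 : ℤ) : ℤ_[p])‖ = 1 :=
    le_antisymm (PadicInt.norm_le_one _)
      (not_lt.mp fun h => hd ((PadicInt.norm_int_lt_one_iff_dvd _).mp h))
  obtain ⟨θ, h0, hθ, -⟩ := hensels_lemma (p := p) (F := f) (a := (r : ℤ_[p])) (by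
    rw [hf, hf', h1, one_pow]
    have := (PadicInt.norm_int_lt_one_iff_dvd (p := p) _).mpr hr
    exact_mod_cast this)
  refine ⟨θ, eq_neg_of_add_eq_zero_left (by rw [← hf]; exact h0), ?_⟩
  rw [hf', h1] at hθ
  have : θ - r ∈ RingHom.ker (PadicInt.toZMod (p := p)) := by
    rw [PadicInt.ker_toZMod, IsLocalRing.mem_maximalIdeal, PadicInt.mem_nonunits]
    exact hθ
  rw [RingHom.mem_ker, map_sub, sub_eq_zero] at this
  simpa using this

theorem PadicInt.isSquare_of_isSquare_coe {z : ℤ_[p]} (h : IsSquare (z : ℚ_[p])) :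
    IsSquare z := by
  obtain ⟨w, hw⟩ := h
  have hw1 : ‖w‖ ≤ 1 := by
    have hz := PadicInt.norm_le_one z
    rw [PadicInt.norm_def, hw, norm_mul] at hz
    nlinarith [norm_nonneg w]
  exact ⟨⟨w, hw1⟩, PadicInt.ext hw⟩

/-- If `-K` is not a cube modulo `p`, then it is not a cube in `ℚ`. -/
theorem ratCast_pow_three_ne_of_zmod {K a : ℤ} (hKa : (p : ℤ) ∣ K - a)
    (h : ∀ t : ZMod p, t ^ 3 ≠ -(a : ZMod p)) (x : ℚ) :
    x ^ 3 ≠ -(K : ℚ) := by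
  intro hx
  have hx' : (x : ℚ_[p]) ^ 3 = -(K : ℚ_[p]) := by exact_mod_cast congrArg (Rat.cast (K := ℚ_[p])) hx
  -- The cube of `x` is an integer, so `x` is `p`-integral and can be reduced mod `p`.
  have hx1 : ‖(x : ℚ_[p])‖ ≤ 1 := by
    have := congrArg norm hx'
    rw [norm_pow, norm_neg] at this
    have hK := Padic.norm_int_le_one (p := p) K
    rw [← this] at hK
    exact (pow_le_one_iff_of_nonneg (norm_nonneg _) three_ne_zero).mp hK
  obtain ⟨z, hz⟩ : ∃ z : ℤ_[p], (z : ℚ_[p]) = x := ⟨⟨x, hx1⟩, rfl⟩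
  have hz : z ^ 3 = -(K : ℤ_[p]) := PadicInt.ext (by push_cast; rw [hz, hx'])
  apply h (PadicInt.toZMod z)
  rw [← map_pow, hz, map_neg, map_intCast, neg_inj,
    ZMod.intCast_eq_intCast_iff_dvd_sub, dvd_sub_comm]
  exact hKa

theorem isSquare_prod_zmod_of_sum_eq {K r : ℤ} (hr : (p : ℤ) ∣ r ^ 3 + K)
    (hd : ¬ (p : ℤ) ∣ 3 * r ^ 2) (hK : ∀ x : ℚ, x ^ 3 ≠ -(K : ℚ)) {ι : Type*} (S : Finset ι)
    (P : ι → MordellGroup K) (X : ι → ℤ)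
    (hP : ∀ i, ∃ (y : ℚ) (h : _), P i = .some (X i : ℚ) y h) {Q : MordellGroup K} (hQ : ∑ i ∈ S,
        P i = 2 • Q) :
    IsSquare (∏ i ∈ S, ((X i - r : ℤ) : ZMod p)) := by
  obtain ⟨θ, hθ, hθr⟩ := PadicInt.exists_cube_root p hr hd
  have hsq := isSquare_prod_descentMap (θ : ℚ_[p]) hK (by exact_mod_cast congrArg _ hθ) S P hQ
  have hprod : ∏ i ∈ S, descentMap (θ : ℚ_[p]) (P i) = PadicInt.Coe.ringHom (∏ i ∈ S, ((X i :
      ℤ_[p]) - θ)) := by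
    rw [map_prod]
    refine Finset.prod_congr rfl fun i _ => ?_
    obtain ⟨y, h, hi⟩ := hP i
    rw [hi]
    simp [descentMap]
    rfl
  rw [hprod] at hsq
  have := (PadicInt.isSquare_of_isSquare_coe p hsq).map (PadicInt.toZMod (p := p))
  rw [map_prod] at this
  simpa [hθr] using this

/-- The product is the character of a square mod `p`. That square may be `0`, hence `≠ -1` rather
than `= 1`. -/
theorem prod_legendreSym_of_sum_eq {K r : ℤ} (hr : (p : ℤ) ∣ r ^ 3 + K)
    (hd : ¬ (p : ℤ) ∣ 3 * r ^ 2) (hK : ∀ x : ℚ, x ^ 3 ≠ -(K : ℚ)) {ι : Type*} (S : Finset ι)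
    (P : ι → MordellGroup K) (X : ι → ℤ)
    (hP : ∀ i, ∃ (y : ℚ) (h : _), P i = .some (X i : ℚ) y h) {Q : MordellGroup K} (hQ : ∑ i ∈ S,
        P i = 2 • Q) :
    ∏ i ∈ S, legendreSym p (X i - r) ≠ -1 := by
  have h := isSquare_prod_zmod_of_sum_eq p hr hd hK S P X hP hQ
  obtain ⟨w, hw⟩ := h
  simp only [legendreSym]
  rw [← map_prod, hw, map_mul]
  intro h
  nlinarith [mul_self_nonneg (quadraticChar (ZMod p) w)]

end Padic

/-- Independence of points with integral `x`-coordinates `X i`, from a table of Legendre symbols of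
`X i - r` with `r ^ 3 = -K` modulo several primes. -/
theorem linearIndependent_of_legendreSym {ι κ : Type*} [Fintype ι] {K : ℤ} {k : ℚ} (hkK : k = K)
    (hK : ∀ x : ℚ, x ^ 3 ≠ -(K : ℚ))
    (P : ι → MordellGroup k) (X : ι → ℤ) (hP : ∀ i, ∃ y h, P i = .some (X i : ℚ) y h)
    (p : κ → ℕ) [∀ j, Fact (p j).Prime] (r : κ → ℤ)
    (hr : ∀ j, (p j : ℤ) ∣ r j ^ 3 + K) (hd : ∀ j, ¬ (p j : ℤ) ∣ 3 * r j ^ 2)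
    (c : κ → ι → ℤ) (hc : ∀ j i, legendreSym (p j) (X i - r j) = c j i)
    (hS : ∀ S : Finset ι, (∀ j, ∏ i ∈ S, c j i ≠ -1) → S = ∅) :
    LinearIndependent ℤ P := by
  subst hkK
  refine linearIndependent_int_of_sum_ne_two_nsmul (two_nsmul_mordell_ne_zero hK) P
    fun S Q hQ => hS S fun j => ?_
  simp only [← hc]
  exact prod_legendreSym_of_sum_eq (p j) (hr j) (hd j) hK S P X hP hQ

/-! ### Points from coordinates, and relations between them -/

theorem mordellCurve_nonsingular {k x y : ℚ} (hk : k ≠ 0) (h : y ^ 2 = x ^ 3 + k) :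
    (mordellCurve k).toAffine.Nonsingular x y := by
  have := mordellCurve_isElliptic hk
  exact (WeierstrassCurve.Affine.equation_iff_nonsingular).mp
    ((mordellCurve_equation_iff k x y).mpr h)

/-- The identity is `((x³ + y³ - z³)/2)² - (xy)³ = φ(x, y, z)/4`, and `φ` is symmetric. -/
theorem chainCoords_equation {k : ℚ} {c : Fin 3 → Fin 3 → ℚ} (hc : IsSexticChain k c)
    (ij : Fin 3 × Fin 3) :
    (chainCoords c ij).2 ^ 2 = (chainCoords c ij).1 ^ 3 + k := by
  obtain ⟨i, j⟩ := ij
  have h := hc i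
  simp only [sexticForm] at h
  fin_cases j <;> simp [chainCoords] <;> linear_combination h / 4

theorem exists_haveCoords {ι : Type} {k : ℚ} (hk : k ≠ 0) (L : ι → ℚ × ℚ)
    (hL : ∀ i, (L i).2 ^ 2 = (L i).1 ^ 3 + k) : ∃ P : ι → MordellGroup k, HaveCoords k P L :=
  ⟨fun i => .some _ _ (mordellCurve_nonsingular hk (hL i)), fun _ => ⟨_, rfl⟩⟩

theorem HaveCoords.exists_eq_some {ι : Type} {k : ℚ} {P : ι → MordellGroup k} {L : ι → ℚ × ℚ}
    (hP : HaveCoords k P L) {i : ι} {x : ℚ} (hx : (L i).1 = x) : ∃ y h, P i = .some x y h := by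
  subst hx
  exact ⟨_, hP i⟩

/-- The abscissas already separate the points, and over `ℤ` this is decidable. -/
theorem injective_of_fst_eq_intCast {ι : Type} {L : ι → ℚ × ℚ} {X : ι → ℤ}
    (hX : Function.Injective X) (hL : ∀ i, (L i).1 = X i) : Function.Injective L := by
  intro a b h
  apply hX
  have := congrArg Prod.fst h
  rw [hL, hL] at this
  exact_mod_cast this

theorem range_eq_range_of_comp {α β γ : Type*} {f : α → γ} {g : β → γ} (u : α → β) (v : β → α)
    (hu : ∀ a, g (u a) = f a) (hv : ∀ b, f (v b) = g b) : Set.range f = Set.range g :=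
  Set.Subset.antisymm (Set.range_subset_iff.mpr fun a => ⟨u a, hu a⟩)
    (Set.range_subset_iff.mpr fun b => ⟨v b, hv b⟩)

/-- The chords through two pairs of points give the same sum. -/
theorem HaveCoords.add_eq_add {ι : Type} {k : ℚ} {P : ι → MordellGroup k} {L : ι → ℚ × ℚ}
    (h : HaveCoords k P L) {a b c d : ι} (ℓ m : ℚ) (hab : (L a).1 ≠ (L b).1)
    (hcd : (L c).1 ≠ (L d).1)
    (hℓ : (L a).2 - (L b).2 = ℓ * ((L a).1 - (L b).1))
    (hm : (L c).2 - (L d).2 = m * ((L c).1 - (L d).1))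
    (hx : ℓ ^ 2 - (L a).1 - (L b).1 = m ^ 2 - (L c).1 - (L d).1)
    (hy : ℓ * (ℓ ^ 2 - 2 * (L a).1 - (L b).1) + (L a).2
      = m * (m ^ 2 - 2 * (L c).1 - (L d).1) + (L c).2) :
    P a + P b = P c + P d := by
  obtain ⟨ha, hPa⟩ := h a
  obtain ⟨hb, hPb⟩ := h b
  obtain ⟨hc, hPc⟩ := h c
  obtain ⟨hd, hPd⟩ := h d
  have hℓ' : ((L a).2 - (L b).2) / ((L a).1 - (L b).1) = ℓ := by
    rw [hℓ, mul_div_cancel_right₀ _ (sub_ne_zero.mpr hab)]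
  have hm' : ((L c).2 - (L d).2) / ((L c).1 - (L d).1) = m := by
    rw [hm, mul_div_cancel_right₀ _ (sub_ne_zero.mpr hcd)]
  rw [hPa, hPb, hPc, hPd, WeierstrassCurve.Affine.Point.add_of_X_ne hab,
    WeierstrassCurve.Affine.Point.add_of_X_ne hcd, WeierstrassCurve.Affine.Point.some.injEq]
  simp only [WeierstrassCurve.Affine.slope_of_X_ne hab, WeierstrassCurve.Affine.slope_of_X_ne hcd,
    WeierstrassCurve.Affine.addX, WeierstrassCurve.Affine.addY, WeierstrassCurve.Affine.negAddY,
    WeierstrassCurve.Affine.negY, hℓ', hm', mordellCurve]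
  exact ⟨by linear_combination hx, by linear_combination -hy⟩

/-- The positions of six points of a chain that generate all nine. -/
def magicBasis : Fin 6 → Fin 3 × Fin 3 :=
  ![(0, 0), (0, 1), (0, 2), (1, 0), (1, 1), (2, 1)]

theorem rank_span_range_eq_six {A : Type} [AddCommGroup A] {P : Fin 3 × Fin 3 → A}
    (hli : LinearIndependent ℤ fun i => P (magicBasis i))
    (h₁ : P (0, 1) + P (0, 2) = P (1, 0) + P (2, 0))
    (h₂ : P (0, 0) + P (2, 0) = P (1, 1) + P (1, 2))
    (h₃ : P (0, 0) + P (1, 0) = P (2, 1) + P (2, 2)) :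
    Module.rank ℤ (Submodule.span ℤ (Set.range P)) = 6 := by
  set V := Submodule.span ℤ (Set.range fun i => P (magicBasis i))
  have hV (i : Fin 6) : P (magicBasis i) ∈ V := Submodule.subset_span ⟨i, rfl⟩
  -- This point comes first because the relation for `P (1, 2)` involves it.
  have h20 : P (2, 0) ∈ V := by
    rw [eq_sub_of_add_eq' h₁.symm]
    exact V.sub_mem (V.add_mem (hV 1) (hV 2)) (hV 3)
  have h12 : P (1, 2) ∈ V := by
    rw [eq_sub_of_add_eq' h₂.symm]
    exact V.sub_mem (V.add_mem (hV 0) h20) (hV 4)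
  have h22 : P (2, 2) ∈ V := by
    rw [eq_sub_of_add_eq' h₃.symm]
    exact V.sub_mem (V.add_mem (hV 0) (hV 3)) (hV 5)
  have hspan : Submodule.span ℤ (Set.range P) = V := by
    apply le_antisymm
    · rw [Submodule.span_le]
      rintro _ ⟨⟨i, j⟩, rfl⟩
      fin_cases i <;> fin_cases j
      exacts [hV 0, hV 1, hV 2, hV 3, hV 4, h12, h20, hV 5, h22]
    · exact Submodule.span_mono (Set.range_comp_subset_range magicBasis P)
  rw [hspan, rank_span hli, Cardinal.mk_range_eq _ hli.injective]
  simp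

theorem six_le_rank {A : Type} [AddCommGroup A] {v : Fin 6 → A} (hv : LinearIndependent ℤ v) :
    6 ≤ Module.rank ℤ A := by
  simpa using hv.cardinal_le_rank

/-! ### Legendre symbol certificates for the four curves -/

instance fact_prime_7 : Fact (Nat.Prime 7) := ⟨by norm_num⟩
instance fact_prime_11 : Fact (Nat.Prime 11) := ⟨by norm_num⟩
instance fact_prime_13 : Fact (Nat.Prime 13) := ⟨by norm_num⟩
instance fact_prime_17 : Fact (Nat.Prime 17) := ⟨by norm_num⟩
instance fact_prime_19 : Fact (Nat.Prime 19) := ⟨by norm_num⟩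
instance fact_prime_23 : Fact (Nat.Prime 23) := ⟨by norm_num⟩
instance fact_prime_41 : Fact (Nat.Prime 41) := ⟨by norm_num⟩
instance fact_prime_47 : Fact (Nat.Prime 47) := ⟨by norm_num⟩
instance fact_prime_53 : Fact (Nat.Prime 53) := ⟨by norm_num⟩
instance fact_prime_59 : Fact (Nat.Prime 59) := ⟨by norm_num⟩
instance fact_prime_61 : Fact (Nat.Prime 61) := ⟨by norm_num⟩
instance fact_prime_67 : Fact (Nat.Prime 67) := ⟨by norm_num⟩
instance fact_prime_83 : Fact (Nat.Prime 83) := ⟨by norm_num⟩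

theorem pow_three_ne_neg₁ (x : ℚ) : x ^ 3 ≠ -((44906825622115054978352852841 : ℤ) : ℚ) := by
  -- The modulus must be `1` mod `3`, since otherwise every residue is a cube; `a` is the residue of
  -- `K`.
  exact ratCast_pow_three_ne_of_zmod 7 (a := 3) (by norm_num) (by decide) x

theorem linearIndependent_points₁ (P : Fin 6 → MordellGroup 44906825622115054978352852841)
    (hP : ∀ i, ∃ y h, P i = .some ((![42907150, 48135075, 11434402122, -450561081, -536829150,
        -42344445] : Fin 6 → ℤ) i : ℚ) y h) :
    LinearIndependent ℤ P := by
  have hp : ∀ j, Fact (Nat.Prime ((![23, 41, 53, 59, 61, 67] : Fin 6 → ℕ) j)) := by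
    simp only [Fin.forall_fin_succ]
    exact ⟨fact_prime_23, fact_prime_41, fact_prime_53, fact_prime_59, fact_prime_61,
        fact_prime_67, nofun⟩
  refine linearIndependent_of_legendreSym (K := 44906825622115054978352852841)
      (by norm_num) pow_three_ne_neg₁ P _ hP
    -- The primes, then a cube root of `-K` modulo each. The sign table, one row per prime, is
    -- invertible over `𝔽₂`; the last `decide` runs over all 64 subsets.
    ![23, 41, 53, 59, 61, 67] ![19, 24, 38, 11, 18, 46] (by decide) (by decide)
    ![![-1, 1, 1, -1, 1, 1],
      ![-1, -1, 1, 1, 1, -1],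
      ![-1, 1, 1, 1, -1, -1],
      ![-1, -1, 1, 1, -1, 1],
      ![-1, -1, -1, -1, -1, -1],
      ![1, -1, 1, 1, -1, -1]]
    (fun j i => ?_) (by decide)
  fin_cases j <;> fin_cases i <;> simp <;> norm_num

theorem pow_three_ne_neg₂ (x : ℚ) : x ^ 3 ≠ -((60881141602872940726223731917150516833400 : ℤ) :
    ℚ) := by
  exact ratCast_pow_three_ne_of_zmod 13 (a := 4) (by norm_num) (by decide) x

theorem linearIndependent_points₂ (P :
    Fin 6 → MordellGroup 60881141602872940726223731917150516833400)
    (hP : ∀ i, ∃ y h, P i = .some ((![-36677120373866, 226412186327985, -37401656636490,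
        36756276620569, 174559636636770, 61756808264886] : Fin 6 → ℤ) i : ℚ) y h) :
    LinearIndependent ℤ P := by
  have hp : ∀ j, Fact (Nat.Prime ((![11, 17, 19, 23, 41, 83] : Fin 6 → ℕ) j)) := by
    simp only [Fin.forall_fin_succ]
    exact ⟨fact_prime_11, fact_prime_17, fact_prime_19, fact_prime_23, fact_prime_41,
        fact_prime_83, nofun⟩
  refine linearIndependent_of_legendreSym (K := 60881141602872940726223731917150516833400)
      (by norm_num) pow_three_ne_neg₂ P _ hP
    ![11, 17, 19, 23, 41, 83] ![7, 15, 6, 19, 13, 31] (by decide) (by decide)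
    ![![-1, -1, 1, 1, 1, -1],
      ![-1, -1, -1, 1, 1, -1],
      ![-1, 1, 1, 1, -1, -1],
      ![1, -1, -1, 1, 1, -1],
      ![1, -1, -1, 1, -1, -1],
      ![-1, -1, -1, -1, -1, -1]]
    (fun j i => ?_) (by decide)
  fin_cases j <;> fin_cases i <;> simp <;> norm_num

theorem pow_three_ne_neg₃ (x : ℚ) :
    x ^ 3 ≠ -((229891413360054031954393983295868363569423090881015580599000 : ℤ) : ℚ) := by
  exact ratCast_pow_three_ne_of_zmod 7 (a := 3) (by norm_num) (by decide) x

theorem linearIndependent_points₃ (P :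
    Fin 6 → MordellGroup 229891413360054031954393983295868363569423090881015580599000)
    (hP : ∀ i, ∃ y h, P i = .some ((![-54294070896871914194, -56002742256815248434,
        305766172807544341929, 52117423672913669521, 58795689719569268010,
            116382252557617775310] : Fin 6 → ℤ) i : ℚ) y h) :
    LinearIndependent ℤ P := by
  have hp : ∀ j, Fact (Nat.Prime ((![17, 23, 41, 47, 53, 59] : Fin 6 → ℕ) j)) := by
    simp only [Fin.forall_fin_succ]
    exact ⟨fact_prime_17, fact_prime_23, fact_prime_41, fact_prime_47, fact_prime_53,
        fact_prime_59, nofun⟩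
  refine linearIndependent_of_legendreSym (K :=
      229891413360054031954393983295868363569423090881015580599000)
          (by norm_num) pow_three_ne_neg₃ P _ hP
    ![17, 23, 41, 47, 53, 59] ![5, 15, 28, 16, 29, 37] (by decide) (by decide)
    ![![-1, -1, -1, -1, 1, 1],
      ![-1, -1, 1, 1, 1, -1],
      ![1, 1, 1, -1, -1, -1],
      ![-1, 1, -1, 1, -1, 1],
      ![1, 1, 1, 1, 1, -1],
      ![1, 1, 1, 1, -1, 1]]
    (fun j i => ?_) (by decide)
  fin_cases j <;> fin_cases i <;> simp <;> norm_num

theorem pow_three_ne_neg₄ (x : ℚ) :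
    x ^ 3 ≠ -((2929940522529734819579573131655813436044395771052383353330586891185336 : ℤ) : ℚ) :=
        by
  exact ratCast_pow_three_ne_of_zmod 13 (a := 2) (by norm_num) (by decide) x

theorem linearIndependent_points₄ (P :
    Fin 6 → MordellGroup 2929940522529734819579573131655813436044395771052383353330586891185336)
    (hP : ∀ i, ∃ y h, P i = .some ((![-141414732465740654584895, -142146480737818708610910,
        1093146527939261808332082, 155860363359204887583622, 166725869851166429247654,
            191057701011529858060710] : Fin 6 → ℤ) i : ℚ) y h) :
    LinearIndependent ℤ P := by
  have hp : ∀ j, Fact (Nat.Prime ((![11, 17, 23, 41, 47, 53] : Fin 6 → ℕ) j)) := by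
    simp only [Fin.forall_fin_succ]
    exact ⟨fact_prime_11, fact_prime_17, fact_prime_23, fact_prime_41, fact_prime_47,
        fact_prime_53, nofun⟩
  refine linearIndependent_of_legendreSym (K :=
      2929940522529734819579573131655813436044395771052383353330586891185336)
          (by norm_num) pow_three_ne_neg₄ P _ hP
    ![11, 17, 23, 41, 47, 53] ![2, 5, 5, 18, 31, 33] (by decide) (by decide)
    ![![1, 1, -1, -1, -1, -1],
      ![-1, -1, -1, -1, 1, 1],
      ![-1, -1, -1, -1, -1, -1],
      ![1, 1, 1, 1, 1, -1],
      ![1, -1, -1, 1, 1, 1],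
      ![-1, -1, -1, 1, -1, 1]]
    (fun j i => ?_) (by decide)
  fin_cases j <;> fin_cases i <;> simp <;> norm_num

/-! ### The third and fourth chains: span of rank exactly 6 -/

theorem isSexticChain₃ :
    IsSexticChain 229891413360054031954393983295868363569423090881015580599000 chain₃ := by
  intro i
  fin_cases i <;> simp [sexticForm, chain₃] <;> norm_num

/-- The `x`-coordinates of the points of `chain₃`. -/
def chainX₃ : Fin 3 → Fin 3 → ℤ :=
  ![
    ![-54294070896871914194, -56002742256815248434, 305766172807544341929],
    ![52117423672913669521, 58795689719569268010, 229883628237888998010],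
    ![86104535525074598446, 116382252557617775310, 180938878144769014185]]

theorem chainCoords_chain₃_fst (ij : Fin 3 × Fin 3) :
    (chainCoords chain₃ ij).1 = (chainX₃ ij.1 ij.2 : ℚ) := by
  obtain ⟨i, j⟩ := ij
  fin_cases i <;> fin_cases j <;> simp [chainCoords, chain₃, chainX₃] <;> norm_num

theorem chainCoords_chain₃_injective : Function.Injective (chainCoords chain₃) :=
  injective_of_fst_eq_intCast (X := fun ij => chainX₃ ij.1 ij.2) (by decide)
    chainCoords_chain₃_fst

theorem linearIndependent_chain₃ {P :
    Fin 3 × Fin 3 → MordellGroup 229891413360054031954393983295868363569423090881015580599000}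
    (hP : HaveCoords 229891413360054031954393983295868363569423090881015580599000 P
        (chainCoords chain₃)) :
    LinearIndependent ℤ (fun i => P (magicBasis i)) :=
  linearIndependent_points₃ _ fun i => hP.exists_eq_some (by
    rw [chainCoords_chain₃_fst]
    fin_cases i <;> rfl)

theorem rank_span_chain₃ {P :
    Fin 3 × Fin 3 → MordellGroup 229891413360054031954393983295868363569423090881015580599000}
    (hP : HaveCoords 229891413360054031954393983295868363569423090881015580599000 P
        (chainCoords chain₃)) :
    Module.rank ℤ (Submodule.span ℤ (Set.range P)) = 6 := by
  refine rank_span_range_eq_six (linearIndependent_chain₃ hP) ?_ ?_ ?_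
  -- The two rationals are the slopes of the chords through the left and the right pair of points.
  · refine hP.add_eq_add (84029093330041952473/5919730121)
      (-56143725491856746091/5919730121) ?_ ?_ ?_ ?_ ?_ ?_ <;> simp [chainCoords,
          chain₃] <;> norm_num
  · refine hP.add_eq_add (-25522648658402774079/5368018970)
      (89739861990716669521/5368018970) ?_ ?_ ?_ ?_ ?_ ?_ <;> simp [chainCoords,
          chain₃] <;> norm_num
  · refine hP.add_eq_add (-16910345154588316779/5212847945)
      (91784789636174575321/5212847945) ?_ ?_ ?_ ?_ ?_ ?_ <;> simp [chainCoords,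
          chain₃] <;> norm_num

theorem isSexticChain₄ :
    IsSexticChain 2929940522529734819579573131655813436044395771052383353330586891185336 chain₄ :=
        by
  intro i
  fin_cases i <;> simp [sexticForm, chain₄] <;> norm_num

/-- The `x`-coordinates of the points of `chain₄`. -/
def chainX₄ : Fin 3 → Fin 3 → ℤ :=
  ![
    ![-141414732465740654584895, -142146480737818708610910, 1093146527939261808332082],
    ![155860363359204887583622, 166725869851166429247654, 886119545873824972915737],
    ![176585361039170865768070, 191057701011529858060710, 867458331901370064699417]]

theorem chainCoords_chain₄_fst (ij : Fin 3 × Fin 3) :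
    (chainCoords chain₄ ij).1 = (chainX₄ ij.1 ij.2 : ℚ) := by
  obtain ⟨i, j⟩ := ij
  fin_cases i <;> fin_cases j <;> simp [chainCoords, chain₄, chainX₄] <;> norm_num

theorem chainCoords_chain₄_injective : Function.Injective (chainCoords chain₄) :=
  injective_of_fst_eq_intCast (X := fun ij => chainX₄ ij.1 ij.2) (by decide)
    chainCoords_chain₄_fst

theorem linearIndependent_chain₄ {P :
    Fin 3 × Fin 3 → MordellGroup
        2929940522529734819579573131655813436044395771052383353330586891185336}
    (hP : HaveCoords 2929940522529734819579573131655813436044395771052383353330586891185336 P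
        (chainCoords chain₄)) :
    LinearIndependent ℤ (fun i => P (magicBasis i)) :=
  linearIndependent_points₄ _ fun i => hP.exists_eq_some (by
    rw [chainCoords_chain₄_fst]
    fin_cases i <;> rfl)

theorem rank_span_chain₄ {P :
    Fin 3 × Fin 3 → MordellGroup
        2929940522529734819579573131655813436044395771052383353330586891185336}
    (hP : HaveCoords 2929940522529734819579573131655813436044395771052383353330586891185336 P
        (chainCoords chain₄)) :
    Module.rank ℤ (Submodule.span ℤ (Set.range P)) = 6 := by
  refine rank_span_range_eq_six (linearIndependent_chain₄ hP) ?_ ?_ ?_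
  · refine hP.add_eq_add (321497734165910914253953/349412681378)
      (-166859153465144077661583/349412681378) ?_ ?_ ?_ ?_ ?_ ?_ <;> simp [chainCoords,
          chain₄] <;> norm_num
  · refine hP.add_eq_add (-11919098533478744932725/46361824343)
      (48264626646034501753447/46361824343) ?_ ?_ ?_ ?_ ?_ ?_ <;> simp [chainCoords,
          chain₄] <;> norm_num
  · refine hP.add_eq_add (-4108335517934317955937/16996299707)
      (17846103965558471768587/16996299707) ?_ ?_ ?_ ?_ ?_ ?_ <;> simp [chainCoords,
          chain₄] <;> norm_num

/-! ### The first chain -/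

theorem isSexticChain₁ : IsSexticChain 44906825622115054978352852841 chain₁ := by
  intro i
  fin_cases i <;> simp [sexticForm, chain₁] <;> norm_num

/-- The `x`-coordinates of `coords₁`. -/
def coordsX₁ : Fin 7 → ℤ :=
  ![42907150, 48135075, 11434402122, -450561081, -536829150, -42344445, -3553972230]

theorem coords₁_fst (i : Fin 7) : (coords₁ i).1 = (coordsX₁ i : ℚ) := by
  fin_cases i <;> simp [coords₁, coordsX₁]

theorem coords₁_injective : Function.Injective coords₁ :=
  injective_of_fst_eq_intCast (X := coordsX₁) (by decide) coords₁_fst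

theorem coords₁_equation (i : Fin 7) :
    (coords₁ i).2 ^ 2 = (coords₁ i).1 ^ 3 + 44906825622115054978352852841 := by
  fin_cases i <;> simp [coords₁] <;> norm_num

theorem range_coords₁ : Set.range coords₁ =
    Set.range ((chainCoords chain₁)) := by
  refine range_eq_range_of_comp
    -- The first points of the three rows coincide, which leaves seven; the reverse map sends all
    -- three to index `0`.
    ![(0, 0), (0, 1), (0, 2), (1, 1), (1, 2), (2, 1), (2, 2)]
    (fun ij => (![![0, 1, 2], ![0, 3, 4], ![0, 5, 6]] : Fin 3 → Fin 3 → Fin 7) ij.1 ij.2) ?_ ?_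
  · intro i
    fin_cases i <;> simp [coords₁, chainCoords, chain₁] <;> norm_num
  · rintro ⟨i, j⟩
    fin_cases i <;> fin_cases j <;> simp [coords₁, chainCoords, chain₁] <;> norm_num

theorem exists_points_coords₁ : ∃ P : Fin 7 → MordellGroup 44906825622115054978352852841,
    HaveCoords 44906825622115054978352852841 P coords₁ ∧
      LinearIndependent ℤ ![P 0, P 1, P 2, P 3, P 4, P 5] := by
  obtain ⟨P, hP⟩ := exists_haveCoords (by norm_num) coords₁ coords₁_equation
  refine ⟨P, hP, linearIndependent_points₁ _ fun i => ?_⟩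
  fin_cases i
  · exact hP.exists_eq_some (coords₁_fst 0)
  · exact hP.exists_eq_some (coords₁_fst 1)
  · exact hP.exists_eq_some (coords₁_fst 2)
  · exact hP.exists_eq_some (coords₁_fst 3)
  · exact hP.exists_eq_some (coords₁_fst 4)
  · exact hP.exists_eq_some (coords₁_fst 5)

theorem parametricChain_one_two (i j : Fin 3) : parametricChain 1 2 i j = 6 * chain₁ i j := by
  fin_cases i <;> fin_cases j <;> simp [parametricChain, chain₁] <;> norm_num

/-! ### The second chain -/

theorem isSexticChain₂ : IsSexticChain 60881141602872940726223731917150516833400 chain₂ := by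
  intro i
  fin_cases i <;> simp [sexticForm, chain₂] <;> norm_num

/-- The `x`-coordinates of `coords₂`. -/
def coordsX₂ : Fin 9 → ℤ :=
  ![-36677120373866, 226412186327985, -37401656636490, 36756276620569, 174559636636770,
      40595586917970, 52295229628054, 61756808264886, 157458619905969]

theorem coords₂_fst (i : Fin 9) : (coords₂ i).1 = (coordsX₂ i : ℚ) := by
  fin_cases i <;> simp [coords₂, coordsX₂]

theorem coords₂_injective : Function.Injective coords₂ :=
  injective_of_fst_eq_intCast (X := coordsX₂) (by decide) coords₂_fst

theorem coords₂_equation (i : Fin 9) :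
    (coords₂ i).2 ^ 2 = (coords₂ i).1 ^ 3 + 60881141602872940726223731917150516833400 := by
  fin_cases i <;> simp [coords₂] <;> norm_num

theorem range_coords₂ : Set.range coords₂ =
    Set.range (fun ij => ((chainCoords chain₂ ij).1, -(chainCoords chain₂ ij).2)) := by
  refine range_eq_range_of_comp
    ![(0, 0), (0, 2), (0, 1), (1, 0), (1, 2), (1, 1), (2, 0), (2, 2), (2, 1)]
    (fun ij => (![![0, 2, 1], ![3, 5, 4], ![6, 8, 7]] : Fin 3 → Fin 3 → Fin 9) ij.1 ij.2) ?_ ?_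
  · intro i
    fin_cases i <;> simp [coords₂, chainCoords, chain₂] <;> norm_num
  · rintro ⟨i, j⟩
    fin_cases i <;> fin_cases j <;> simp [coords₂, chainCoords, chain₂] <;> norm_num

theorem exists_points_coords₂ : ∃ P :
    Fin 9 → MordellGroup 60881141602872940726223731917150516833400,
    HaveCoords 60881141602872940726223731917150516833400 P coords₂ ∧
      LinearIndependent ℤ ![P 0, P 1, P 2, P 3, P 4, P 7] := by
  obtain ⟨P, hP⟩ := exists_haveCoords (by norm_num) coords₂ coords₂_equation
  -- Indices start at `0`, so the sixth point chosen, `P₈`, has index `7`.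
  refine ⟨P, hP, linearIndependent_points₂ _ fun i => ?_⟩
  fin_cases i
  · exact hP.exists_eq_some (coords₂_fst 0)
  · exact hP.exists_eq_some (coords₂_fst 1)
  · exact hP.exists_eq_some (coords₂_fst 2)
  · exact hP.exists_eq_some (coords₂_fst 3)
  · exact hP.exists_eq_some (coords₂_fst 4)
  · exact hP.exists_eq_some (coords₂_fst 7)

/-! ### Assembly -/

theorem exists_points_chain₃ : ∃ P :
    Fin 3 × Fin 3 → MordellGroup 229891413360054031954393983295868363569423090881015580599000,
    HaveCoords 229891413360054031954393983295868363569423090881015580599000 P (chainCoords chain₃) ∧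
      (∃ s : Fin 6 → Fin 3 × Fin 3, LinearIndependent ℤ (fun i => P (s i))) ∧
      Module.rank ℤ (Submodule.span ℤ (Set.range P)) = 6 := by
  obtain ⟨P, hP⟩ := exists_haveCoords (by norm_num) _ (chainCoords_equation isSexticChain₃)
  exact ⟨P, hP, ⟨magicBasis, linearIndependent_chain₃ hP⟩, rank_span_chain₃ hP⟩

theorem exists_points_chain₄ : ∃ P :
    Fin 3 × Fin 3 → MordellGroup
        2929940522529734819579573131655813436044395771052383353330586891185336,
    HaveCoords 2929940522529734819579573131655813436044395771052383353330586891185336 P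
        (chainCoords chain₄) ∧
      (∃ s : Fin 6 → Fin 3 × Fin 3, LinearIndependent ℤ (fun i => P (s i))) ∧
      Module.rank ℤ (Submodule.span ℤ (Set.range P)) = 6 := by
  obtain ⟨P, hP⟩ := exists_haveCoords (by norm_num) _ (chainCoords_equation isSexticChain₄)
  exact ⟨P, hP, ⟨magicBasis, linearIndependent_chain₄ hP⟩, rank_span_chain₄ hP⟩

theorem mainTheorem3 :
    -- The curve of the chain given by `m = 1`, `n = 2`.
    ((∀ i j, parametricChain 1 2 i j = 6 * chain₁ i j) ∧
      IsSexticChain 44906825622115054978352852841 chain₁ ∧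
      Function.Injective coords₁ ∧
      Set.range coords₁ = Set.range (chainCoords chain₁) ∧
      (∃ P : Fin 7 → MordellGroup 44906825622115054978352852841,
        HaveCoords 44906825622115054978352852841 P coords₁ ∧
        LinearIndependent ℤ ![P 0, P 1, P 2, P 3, P 4, P 5]) ∧
      6 ≤ Module.rank ℤ (MordellGroup 44906825622115054978352852841)) ∧
    -- The curve of the second chain; the listed points are the negatives of those of the chain.
    (IsSexticChain 60881141602872940726223731917150516833400 chain₂ ∧
      Function.Injective coords₂ ∧
      Set.range coords₂ =
        Set.range (fun ij => ((chainCoords chain₂ ij).1, -(chainCoords chain₂ ij).2)) ∧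
      (∃ P : Fin 9 → MordellGroup 60881141602872940726223731917150516833400,
        HaveCoords 60881141602872940726223731917150516833400 P coords₂ ∧
        LinearIndependent ℤ ![P 0, P 1, P 2, P 3, P 4, P 7]) ∧
      6 ≤ Module.rank ℤ (MordellGroup 60881141602872940726223731917150516833400)) ∧
    -- The curve of the third chain.
    (IsSexticChain 229891413360054031954393983295868363569423090881015580599000 chain₃ ∧
      Function.Injective (chainCoords chain₃) ∧
      (∃ P : Fin 3 × Fin 3 →
          MordellGroup 229891413360054031954393983295868363569423090881015580599000,
        HaveCoords 229891413360054031954393983295868363569423090881015580599000 P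
          (chainCoords chain₃) ∧
        (∃ s : Fin 6 → Fin 3 × Fin 3, LinearIndependent ℤ (fun i => P (s i))) ∧
        Module.rank ℤ (Submodule.span ℤ (Set.range P)) = 6) ∧
      6 ≤ Module.rank ℤ
        (MordellGroup 229891413360054031954393983295868363569423090881015580599000)) ∧
    -- The third curve with the 70-digit constant, which is the curve of the fourth chain.
    (IsSexticChain
        2929940522529734819579573131655813436044395771052383353330586891185336 chain₄ ∧
      Function.Injective (chainCoords chain₄) ∧
      (∃ P : Fin 3 × Fin 3 →
          MordellGroup 2929940522529734819579573131655813436044395771052383353330586891185336,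
        HaveCoords 2929940522529734819579573131655813436044395771052383353330586891185336 P
          (chainCoords chain₄) ∧
        (∃ s : Fin 6 → Fin 3 × Fin 3, LinearIndependent ℤ (fun i => P (s i))) ∧
        Module.rank ℤ (Submodule.span ℤ (Set.range P)) = 6) ∧
      6 ≤ Module.rank ℤ
        (MordellGroup
          2929940522529734819579573131655813436044395771052383353330586891185336)) := by
  refine ⟨⟨parametricChain_one_two, isSexticChain₁, coords₁_injective, range_coords₁,
      exists_points_coords₁, ?_⟩,
    ⟨isSexticChain₂, coords₂_injective, range_coords₂, exists_points_coords₂, ?_⟩,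
    ⟨isSexticChain₃, chainCoords_chain₃_injective, exists_points_chain₃, ?_⟩,
    ⟨isSexticChain₄, chainCoords_chain₄_injective, exists_points_chain₄, ?_⟩⟩
  · exact exists_points_coords₁.elim fun _ h => six_le_rank h.2
  · exact exists_points_coords₂.elim fun _ h => six_le_rank h.2
  · exact exists_points_chain₃.elim fun _ h => h.2.1.elim fun _ hs => six_le_rank hs
  · exact exists_points_chain₄.elim fun _ h => h.2.1.elim fun _ hs => six_le_rank hs
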